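/- Let $K$ be a field and let $G$ be a finite simple graph with vertex set $V$ and edge set $E(G)$. For $e\in E(G)$ let $\mathbf a_e\in\{0,1\}^{V}$ be the incidence vector of $e$, and let $I_G\subseteq K[e : e\in E(G)]$ be the toric ideal of $G$, generated by all binomials $\mathbf x^{u}-\mathbf x^{v}$ (with $u,v\in\mathbb N^{E(G)}$) such that $\sum_e u_e\mathbf a_e=\sum_e v_e\mathbf a_e$. For a subgraph $H$ of $G$, regard its toric ideal $I_H$ as an ideal of $K[e: e\in E(G)]$ by extension from $K[e : e\in E(H)]$. For subgraphs $G_1,G_2$ of $G$, the expression $I_G=I_{G_1}+I_{G_2}$ is called a *subgraph splitting* of $I_G$ if this equality holds and $I_{G_1}\neq I_G$, $I_{G_2}\neq I_G$. It is a *minimal splitting* if there are a minimal system of binomial generators $\{f_1,\dots,f_r\}$ of $I_{G_1}$ and a minimal system of binomial generators $\{g_1,\dots,g_t\}$ of $I_{G_2}$ such that $f_1,\dots,f_r,g_1,\dots,g_t$ are $r+t$ distinct elements forming a minimal system of generators of $I_G$ (a minimal system of generators of an ideal is a generating set no proper subset of which generates the ideal). It is a *reduced splitting* if, for all subgraphs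 $H_1$ of $G_1$ and $H_2$ of $G_2$ with $I_G=I_{H_1}+I_{H_2}$, one has $I_{H_1}=I_{G_1}$ and $I_{H_2}=I_{G_2}$. Theorem. Every minimal splitting $I_G=I_{G_1}+I_{G_2}$ of $I_G$ is also a reduced splitting of $I_G$. -/

import Mathlib

open MvPolynomial

namespace GraphToric

/-- A (pure difference) binomial `x^u - x^v`. -/
def IsBinomial {σ K : Type*} [Field K] (f : MvPolynomial σ K) : Prop :=
  ∃ u v : σ →₀ ℕ, f = monomial u 1 - monomial v 1

/-- The toric ideal of a configuration `a` of vectors in `ℕ^V`: it is generated by the binomials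
`x^u - x^v` whose two monomials have the same degree, where `x^u` has degree `∑ i, u i • a i`. -/
noncomputable def toricIdeal (K : Type*) [Field K] {σ V : Type*} (a : σ → V → ℕ) :
    Ideal (MvPolynomial σ K) :=
  Ideal.span {f | ∃ u v : σ →₀ ℕ,
    Finsupp.linearCombination ℕ a u = Finsupp.linearCombination ℕ a v ∧
      f = monomial u 1 - monomial v 1}

/-- The `0/1` incidence vector of an edge. -/
noncomputable def edgeVector {V : Type*} (e : Sym2 V) : V → ℕ :=
  Set.indicator {v | v ∈ e} 1

/-- The toric ideal `I_G` of a graph, in the polynomial ring `K[E(G)]`. -/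
noncomputable def graphIdeal (K : Type*) [Field K] {V : Type*} (G : SimpleGraph V) :
    Ideal (MvPolynomial G.edgeSet K) :=
  toricIdeal K fun e : G.edgeSet => edgeVector e.1

/-- The toric ideal `I_H` of a subgraph `H` of `G`, extended from `K[E(H)]` to `K[E(G)]`. -/
noncomputable def subgraphIdeal (K : Type*) [Field K] {V : Type*} {G : SimpleGraph V}
    (H : G.Subgraph) : Ideal (MvPolynomial G.edgeSet K) :=
  (toricIdeal K fun e : H.edgeSet => edgeVector e.1).map
    (rename (Set.inclusion H.edgeSet_subset) :
      MvPolynomial H.edgeSet K →ₐ[K] MvPolynomial G.edgeSet K)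

/-- `S` is a minimal system of generators of `I`: it generates `I` and no proper subset does. -/
def IsMinimalGeneratingSet {R : Type*} [CommRing R] (I : Ideal R) (S : Set R) : Prop :=
  Minimal (fun T : Set R => Ideal.span T = I) S

/-- `S` is a minimal system of binomial generators of `I`. -/
def IsMinimalBinomialSystem {σ K : Type*} [Field K] (I : Ideal (MvPolynomial σ K))
    (S : Set (MvPolynomial σ K)) : Prop :=
  (∀ f ∈ S, IsBinomial f) ∧ IsMinimalGeneratingSet I S

/-- `I_G = I_{G₁} + I_{G₂}` is a subgraph splitting of `I_G`. -/
def IsSubgraphSplitting (K : Type*) [Field K] {V : Type*} {G : SimpleGraph V}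
    (G₁ G₂ : G.Subgraph) : Prop :=
  graphIdeal K G = subgraphIdeal K G₁ + subgraphIdeal K G₂ ∧
    subgraphIdeal K G₁ ≠ graphIdeal K G ∧ subgraphIdeal K G₂ ≠ graphIdeal K G

/-- The splitting is minimal: minimal binomial systems `f₁, …, f_r` of `I_{G₁}` and `g₁, …, g_t` of
`I_{G₂}` together form a minimal system of `r + t` generators of `I_G`; in particular no `f_i` is
a `g_j`. -/
def IsMinimalSplitting (K : Type*) [Field K] {V : Type*} {G : SimpleGraph V}
    (G₁ G₂ : G.Subgraph) : Prop :=
  IsSubgraphSplitting K G₁ G₂ ∧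
    ∃ S T : Set (MvPolynomial G.edgeSet K),
      IsMinimalBinomialSystem (subgraphIdeal K G₁) S ∧
      IsMinimalBinomialSystem (subgraphIdeal K G₂) T ∧
      Disjoint S T ∧ IsMinimalGeneratingSet (graphIdeal K G) (S ∪ T)

/-- The splitting is reduced: subgraphs of `G₁` and `G₂` whose ideals still sum to `I_G` have the
same ideals as `G₁` and `G₂`. -/
def IsReducedSplitting (K : Type*) [Field K] {V : Type*} {G : SimpleGraph V}
    (G₁ G₂ : G.Subgraph) : Prop :=
  IsSubgraphSplitting K G₁ G₂ ∧
    ∀ H₁ H₂ : G.Subgraph, H₁ ≤ G₁ → H₂ ≤ G₂ →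
      graphIdeal K G = subgraphIdeal K H₁ + subgraphIdeal K H₂ →
        subgraphIdeal K H₁ = subgraphIdeal K G₁ ∧ subgraphIdeal K H₂ = subgraphIdeal K G₂

end GraphToric

namespace GraphToric

attribute [local instance] MvPolynomial.gradedAlgebra

section Graded

variable {σ K : Type*} [Field K]

/-! Edge vectors have coordinate sum 2, so all the ideals are homogeneous, and relations among the
minimal generators `S ∪ T` have coefficients in `𝔪`, the polynomials without constant term. Write `f
∈ S` as `p + q` with `p ∈ I_{H₁} ⊆ (S)` and `q ∈ I_{H₂} ⊆ (T)`. Expanding in `S ∪ T` gives such a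
relation; as `S` and `T` are disjoint, its `S`-part is `p - f`, so `f ∈ I_{H₁} + 𝔪 (S)`. Graded
Nakayama yields `(S) ≤ I_{H₁}`; `T` is symmetric (`span_le_of_le_sup`). -/

theorem homogeneousComponent_mul_of_isHomogeneous_right (n : ℕ) (p : MvPolynomial σ K)
    {q : MvPolynomial σ K} {j : ℕ} (hq : q.IsHomogeneous j) :
    homogeneousComponent n (p * q) =
      if j ≤ n then homogeneousComponent (n - j) p * q else 0 := by
  have hdec (r : MvPolynomial σ K) (i : ℕ) :
      (DirectSum.decompose (homogeneousSubmodule σ K) r i : MvPolynomial σ K) =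
        homogeneousComponent i r :=
    decomposition.decompose'_apply r i
  rw [← hdec, ← hdec]
  exact DirectSum.coe_decompose_mul_of_right_mem (homogeneousSubmodule σ K) n
    ((mem_homogeneousSubmodule j q).2 hq)

/-- Graded Nakayama: an ideal `I` contained in `J + 𝔪 I`, where `𝔪` is the ideal of
polynomials without constant term and `J` is homogeneous, is contained in `J`. -/
theorem le_of_le_sup_ker_constantCoeff_mul {I J : Ideal (MvPolynomial σ K)}
    (hJ : J.IsHomogeneous (homogeneousSubmodule σ K))
    (h : I ≤ J ⊔ RingHom.ker (constantCoeff (σ := σ) (R := K)) * I) : I ≤ J := by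
  have key : ∀ d, ∀ x ∈ I, homogeneousComponent d x ∈ J := by
    intro d
    induction d using Nat.strong_induction_on with
    | _ d ih =>
      intro x hx
      obtain ⟨y, hy, z, hz, rfl⟩ := Submodule.mem_sup.1 (h hx)
      rw [map_add]
      refine J.add_mem (homogeneousComponent_mem_of_mem hJ hy d) ?_
      clear hx
      induction hz using Submodule.mul_induction_on' with
      | mem_mul_mem a ha b hb =>
        -- Only `b` is split: its components of degree below `d` lie in `J` by induction, and its
        -- degree-`d` component is multiplied by the constant term of `a`, which is zero.
        rw [← sum_homogeneousComponent b, Finset.mul_sum, map_sum]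
        refine J.sum_mem fun j _ => ?_
        rw [homogeneousComponent_mul_of_isHomogeneous_right d a
          (homogeneousComponent_isHomogeneous j b)]
        split_ifs with hjd
        · rcases hjd.lt_or_eq with hlt | rfl
          · exact J.mul_mem_left _ (ih j hlt b hb)
          · have ha' : coeff 0 a = 0 := ha
            rw [Nat.sub_self, homogeneousComponent_zero, ha', C_0, zero_mul]
            exact J.zero_mem
        · exact J.zero_mem
      | add a ha b hb iha ihb =>
        rw [map_add]
        exact J.add_mem iha ihb
  intro x hx
  rw [← sum_homogeneousComponent x]
  exact J.sum_mem fun d _ => key d x hx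

/-- A minimal homogeneous generating set is linearly independent modulo the ideal of polynomials
without constant term. -/
theorem constantCoeff_eq_zero_of_linearCombination_eq_zero {I : Ideal (MvPolynomial σ K)}
    {X : Set (MvPolynomial σ K)} (hX : IsMinimalGeneratingSet I X)
    (hhom : ∀ x ∈ X, ∃ d, x.IsHomogeneous d)
    {l : MvPolynomial σ K →₀ MvPolynomial σ K}
    (hl : l ∈ Finsupp.supported (MvPolynomial σ K) (MvPolynomial σ K) X)
    (h0 : Finsupp.linearCombination (MvPolynomial σ K) id l = 0)
    (x : MvPolynomial σ K) : constantCoeff (l x) = 0 := by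
  classical
  by_contra hc
  have hxs : x ∈ l.support := by
    rw [Finsupp.mem_support_iff]
    rintro h
    exact hc (by rw [h, map_zero])
  have hxX : x ∈ X := hl hxs
  obtain ⟨d, hd⟩ := hhom x hxX
  rw [Finsupp.linearCombination_apply, Finsupp.sum] at h0
  -- In degree `d = deg x` the relation reads: constant term of `l x` times `x`, plus a combination
  -- of the other generators. A nonzero constant would make `x` redundant.
  have h1 := congrArg (homogeneousComponent d) h0
  rw [map_sum, map_zero, ← Finset.add_sum_erase _ _ hxs] at h1
  simp only [id, smul_eq_mul] at h1
  rw [homogeneousComponent_mul_of_isHomogeneous_right d _ hd, if_pos le_rfl, Nat.sub_self,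
    homogeneousComponent_zero] at h1
  have hrest : ∑ y ∈ l.support.erase x, homogeneousComponent d (l y * y) ∈
      Ideal.span (X \ {x}) := by
    refine Ideal.sum_mem _ fun y hy => ?_
    obtain ⟨hyx, hys⟩ := Finset.mem_erase.1 hy
    have hyX : y ∈ X := hl hys
    obtain ⟨e, he⟩ := hhom y hyX
    rw [homogeneousComponent_mul_of_isHomogeneous_right d _ he]
    split_ifs
    · exact Ideal.mul_mem_left _ _ (Ideal.subset_span ⟨hyX, hyx⟩)
    · exact Ideal.zero_mem _
  have hx' : x ∈ Ideal.span (X \ {x}) := by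
    have h2 : C (coeff 0 (l x)) * x ∈ Ideal.span (X \ {x}) := by
      rw [eq_neg_of_add_eq_zero_left h1]
      exact neg_mem hrest
    have h3 := Ideal.mul_mem_left _ (C (coeff 0 (l x))⁻¹) h2
    rwa [← mul_assoc, ← C_mul, inv_mul_cancel₀ (by exact hc), C_1, one_mul] at h3
  have hspan : Ideal.span (X \ {x}) = I := by
    refine le_antisymm (hX.1 ▸ Ideal.span_mono Set.sdiff_subset) ?_
    rw [← hX.1, Ideal.span_le]
    intro y hy
    by_cases hyx : y = x
    · rwa [hyx]
    · exact Ideal.subset_span ⟨hy, hyx⟩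
  exact (hX.2 hspan Set.sdiff_subset hxX).2 rfl

/-- If homogeneous generators `S` and `T` of two ideals are disjoint and together minimal, then the
first ideal is contained in every homogeneous ideal `J₁ ≤ (S)` for which some `J₂ ≤ (T)` satisfies
`S ⊆ J₁ + J₂`. -/
theorem span_le_of_le_sup {I J₁ J₂ : Ideal (MvPolynomial σ K)} {S T : Set (MvPolynomial σ K)}
    (hST : Disjoint S T) (hmin : IsMinimalGeneratingSet I (S ∪ T))
    (hhom : ∀ x ∈ S ∪ T, ∃ d, x.IsHomogeneous d)
    (hJ : J₁.IsHomogeneous (homogeneousSubmodule σ K))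
    (h₁ : J₁ ≤ Ideal.span S) (h₂ : J₂ ≤ Ideal.span T) (h : Ideal.span S ≤ J₁ ⊔ J₂) :
    Ideal.span S ≤ J₁ := by
  classical
  refine le_of_le_sup_ker_constantCoeff_mul hJ ?_
  rw [Ideal.span_le]
  intro f hf
  obtain ⟨p, hp, q, hq, hpq⟩ := Submodule.mem_sup.1 (h (Ideal.subset_span hf))
  have hp' : p ∈ Submodule.span (MvPolynomial σ K) (id '' S) := by rw [Set.image_id]; exact h₁ hp
  have hq' : q ∈ Submodule.span (MvPolynomial σ K) (id '' T) := by rw [Set.image_id]; exact h₂ hq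
  obtain ⟨a, ha, hap⟩ := (Finsupp.mem_span_image_iff_linearCombination _).1 hp'
  obtain ⟨b, hb, hbq⟩ := (Finsupp.mem_span_image_iff_linearCombination _).1 hq'
  set c := a - Finsupp.single f 1 with hc
  have hcS : c ∈ Finsupp.supported (MvPolynomial σ K) (MvPolynomial σ K) S :=
    Submodule.sub_mem _ ha (Finsupp.single_mem_supported _ _ hf)
  have hcp : Finsupp.linearCombination (MvPolynomial σ K) id c = p - f := by
    rw [hc, map_sub, hap, Finsupp.linearCombination_single, one_smul, id]
  have hsupp : c + b ∈ Finsupp.supported (MvPolynomial σ K) (MvPolynomial σ K) (S ∪ T) :=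
    Submodule.add_mem _ (Finsupp.supported_mono Set.subset_union_left hcS)
      (Finsupp.supported_mono Set.subset_union_right hb)
  have hzero : Finsupp.linearCombination (MvPolynomial σ K) id (c + b) = 0 := by
    rw [map_add, hcp, hbq, ← hpq]
    ring
  have hmem : p - f ∈ RingHom.ker (constantCoeff (σ := σ) (R := K)) * Ideal.span S := by
    rw [← hcp, Finsupp.linearCombination_apply]
    refine Ideal.sum_mem _ fun s hs => ?_
    have hsS : s ∈ S := hcS hs
    -- Disjointness prevents `b` from altering the coefficient at `s`, so `c s` is a coefficient of
    -- the relation `c + b`.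
    have hbs : b s = 0 := by
      by_contra hne
      exact Set.disjoint_left.1 hST hsS (hb (Finsupp.mem_support_iff.2 hne))
    refine Ideal.mul_mem_mul ?_ (Ideal.subset_span hsS)
    have := constantCoeff_eq_zero_of_linearCombination_eq_zero hmin hhom hsupp hzero s
    rwa [Finsupp.add_apply, hbs, add_zero] at this
  have hf' : f = p + -(p - f) := by ring
  rw [SetLike.mem_coe, hf']
  exact Submodule.add_mem_sup hp (neg_mem hmem)

end Graded

section Toric

variable {K : Type*} [Field K] {V : Type*}

/-- Summing coordinates sends `∑ u i • a i` to `k` times the degree of `u`. -/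
theorem degree_eq_of_linearCombination_eq {σ : Type*} [Fintype V] {a : σ → V → ℕ} {k : ℕ}
    (hk : k ≠ 0) (ha : ∀ i, ∑ v, a i v = k) {u w : σ →₀ ℕ}
    (h : Finsupp.linearCombination ℕ a u = Finsupp.linearCombination ℕ a w) :
    u.degree = w.degree := by
  have key : ∀ u : σ →₀ ℕ, ∑ v, Finsupp.linearCombination ℕ a u v = u.degree * k := by
    intro u
    simp only [Finsupp.linearCombination_apply, Finsupp.sum, Finset.sum_apply, Pi.smul_apply]
    rw [Finset.sum_comm]
    simp only [smul_eq_mul, ← Finset.mul_sum, ha, ← Finset.sum_mul]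
    rfl
  have h' := key u
  rw [h, key w] at h'
  exact (Nat.eq_of_mul_eq_mul_right (Nat.pos_of_ne_zero hk) h').symm

theorem sum_edgeVector [Fintype V] {e : Sym2 V} (he : ¬ e.IsDiag) : ∑ v, edgeVector e v = 2 := by
  classical
  induction e using Sym2.inductionOn with
  | _ x y =>
    have hxy : x ≠ y := by simpa using he
    simp only [edgeVector, Set.indicator_apply, Set.mem_ofPred_eq, Sym2.mem_iff, Pi.one_apply]
    rw [Finset.sum_boole]
    have : Finset.univ.filter (fun v => v = x ∨ v = y) = {x, y} := by ext; simp
    rw [this, Finset.card_pair hxy]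
    rfl

theorem isHomogeneous_monomial_sub_monomial {σ : Type*} {u w : σ →₀ ℕ}
    (h : u.degree = w.degree) :
    (monomial u 1 - monomial w 1 : MvPolynomial σ K).IsHomogeneous u.degree :=
  (isHomogeneous_monomial 1 rfl).sub (isHomogeneous_monomial 1 h.symm)

theorem map_rename_toricIdeal_le {σ τ : Type*} {a : σ → V → ℕ} {b : τ → V → ℕ} (φ : σ → τ)
    (h : ∀ i, b (φ i) = a i) :
    (toricIdeal K a).map (rename φ : MvPolynomial σ K →ₐ[K] MvPolynomial τ K) ≤
      toricIdeal K b := by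
  rw [toricIdeal, Ideal.map_span, Ideal.span_le]
  rintro _ ⟨_, ⟨u, w, huw, rfl⟩, rfl⟩
  have hcomp : b ∘ φ = a := funext h
  refine Ideal.subset_span ⟨u.mapDomain φ, w.mapDomain φ, ?_, ?_⟩
  · rw [Finsupp.linearCombination_mapDomain, Finsupp.linearCombination_mapDomain, hcomp, huw]
  · simp only [map_sub, rename_monomial]

theorem subgraphIdeal_mono {G : SimpleGraph V} {H H' : G.Subgraph} (h : H ≤ H') :
    subgraphIdeal K H ≤ subgraphIdeal K H' := by
  have hle := map_rename_toricIdeal_le (K := K) (a := fun e : H.edgeSet => edgeVector e.1)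
    (b := fun e : H'.edgeSet => edgeVector e.1)
    (Set.inclusion (SimpleGraph.Subgraph.edgeSet_mono h)) fun _ => rfl
  have hmap := Ideal.map_mono (f := (rename (Set.inclusion H'.edgeSet_subset) :
    MvPolynomial H'.edgeSet K →ₐ[K] MvPolynomial G.edgeSet K)) hle
  refine le_trans (le_of_eq ?_) hmap
  rw [Ideal.map_mapₐ, subgraphIdeal]
  congr 1
  ext e
  simp

theorem subgraphIdeal_isHomogeneous [Finite V] {G : SimpleGraph V} (H : G.Subgraph) :
    (subgraphIdeal K H).IsHomogeneous (homogeneousSubmodule G.edgeSet K) := by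
  cases nonempty_fintype V
  rw [subgraphIdeal, toricIdeal, Ideal.map_span]
  refine Ideal.homogeneous_span _ _ ?_
  rintro _ ⟨_, ⟨u, w, huw, rfl⟩, rfl⟩
  have hdeg := degree_eq_of_linearCombination_eq two_ne_zero (fun e : H.edgeSet =>
    sum_edgeVector (G.not_isDiag_of_mem_edgeSet (H.edgeSet_subset e.2))) huw
  exact ⟨_, (isHomogeneous_monomial_sub_monomial hdeg).rename_isHomogeneous⟩

/-- Sending every variable to a single `X` kills `I_G`, and `X ^ m = X ^ n` forces `m = n`. -/
theorem IsBinomial.exists_isHomogeneous_of_mem_graphIdeal [Finite V] {G : SimpleGraph V}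
    {f : MvPolynomial G.edgeSet K} (hf : IsBinomial f) (hmem : f ∈ graphIdeal K G) :
    ∃ d, f.IsHomogeneous d := by
  cases nonempty_fintype V
  obtain ⟨u, w, rfl⟩ := hf
  let φ : MvPolynomial G.edgeSet K →ₐ[K] Polynomial K := aeval fun _ => Polynomial.X
  have hφ : ∀ u : G.edgeSet →₀ ℕ, φ (monomial u 1) = Polynomial.X ^ u.degree := by
    intro u
    rw [aeval_monomial, map_one, one_mul, Finsupp.prod, Finset.prod_pow_eq_pow_sum]
    rfl
  have hle : graphIdeal K G ≤ RingHom.ker φ := by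
    rw [graphIdeal, toricIdeal, Ideal.span_le]
    rintro _ ⟨u, w, huw, rfl⟩
    have hdeg := degree_eq_of_linearCombination_eq two_ne_zero (fun e : G.edgeSet =>
      sum_edgeVector (G.not_isDiag_of_mem_edgeSet e.2)) huw
    rw [SetLike.mem_coe, RingHom.mem_ker, map_sub, hφ, hφ, hdeg, sub_self]
  have h0 : φ (monomial u 1 - monomial w 1) = 0 := hle hmem
  rw [map_sub, hφ, hφ, sub_eq_zero] at h0
  have hdeg := congrArg Polynomial.natDegree h0
  rw [Polynomial.natDegree_X_pow, Polynomial.natDegree_X_pow] at hdeg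
  exact ⟨_, isHomogeneous_monomial_sub_monomial hdeg⟩

end Toric

end GraphToric

theorem mainTheorem7 (K : Type*) [Field K] {V : Type*} [Finite V] (G : SimpleGraph V)
    (G₁ G₂ : G.Subgraph) (h : GraphToric.IsMinimalSplitting K G₁ G₂) :
    GraphToric.IsReducedSplitting K G₁ G₂ := by
  obtain ⟨hsplit, S, T, ⟨hSbin, hS⟩, ⟨hTbin, hT⟩, hST, hmin⟩ := h
  refine ⟨hsplit, fun H₁ H₂ h₁ h₂ hsum => ?_⟩
  have hhom : ∀ x ∈ S ∪ T, ∃ d, x.IsHomogeneous d := fun x hx =>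
    GraphToric.IsBinomial.exists_isHomogeneous_of_mem_graphIdeal
      (hx.elim (hSbin x) (hTbin x)) (hmin.1 ▸ Ideal.subset_span hx)
  have hm₁ := GraphToric.subgraphIdeal_mono (K := K) h₁
  have hm₂ := GraphToric.subgraphIdeal_mono (K := K) h₂
  have hG : Ideal.span S ⊔ Ideal.span T =
      GraphToric.subgraphIdeal K H₁ ⊔ GraphToric.subgraphIdeal K H₂ := by
    rw [← Ideal.span_union, hmin.1]
    exact hsum
  rw [← hS.1] at hm₁ ⊢
  rw [← hT.1] at hm₂ ⊢
  refine ⟨le_antisymm hm₁ ?_, le_antisymm hm₂ ?_⟩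
  · exact GraphToric.span_le_of_le_sup hST hmin hhom
      (GraphToric.subgraphIdeal_isHomogeneous H₁) hm₁ hm₂ (hG ▸ le_sup_left)
  · rw [Set.union_comm] at hmin hhom
    exact GraphToric.span_le_of_le_sup hST.symm hmin hhom
      (GraphToric.subgraphIdeal_isHomogeneous H₂) hm₂ hm₁
      (by rw [sup_comm, ← hG]; exact le_sup_right)
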